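/- Let $a=(a_1,a_2,\dots)$ and $b=(b_1,b_2,\dots)$ be sequences of integers $\ge 2$, and let $a\cdot b=(a_1b_1,a_2b_2,\dots)$. Let $\mathcal A_n(a)=M_{a_1}(\mathbb C)\otimes\cdots\otimes M_{a_n}(\mathbb C)$ and let $\mathcal A(a)=\varinjlim \mathcal A_n(a)$ be the UHF C*-algebra obtained from the embeddings $x\mapsto x\otimes 1$. Let $\otimes$ denote the minimal tensor product of C*-algebras, and let $\varphi_{a,b}:\mathcal A(a\cdot b)\to\mathcal A(a)\otimes\mathcal A(b)$ be the $*$-isomorphism determined on matrix units by $$\varphi_{a,b}\big(E^{(a_1b_1)}_{j_1,k_1}\otimes\cdots\otimes E^{(a_nb_n)}_{j_n,k_n}\big)=\big(E^{(a_1)}_{j_1',k_1'}\otimes\cdots\otimes E^{(a_n)}_{j_n',k_n'}\big)\otimes\big(E^{(b_1)}_{j_1'',k_1''}\otimes\cdots\otimes E^{(b_n)}_{j_n'',k_n''}\big),$$ where $j_i=b_i(j_i'-1)+j_i''$, $k_i=b_i(k_i'-1)+k_i''$ with $1\le j_i',k_i'\le a_i$ and $1\le j_i'',k_i''\le b_i$.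 For states $\rho_1$ of $\mathcal A(a)$ and $\rho_2$ of $\mathcal A(b)$ put $\rho_1\otimes_\varphi\rho_2=(\rho_1\otimes\rho_2)\circ\varphi_{a,b}$, and for $*$-representations $\pi_1$ of $\mathcal A(a)$ and $\pi_2$ of $\mathcal A(b)$ put $\pi_1\otimes_\varphi\pi_2=(\pi_1\otimes\pi_2)\circ\varphi_{a,b}$. For a sequence $\mathbf T=(T^{(n)})_{n\ge1}$ of positive semidefinite matrices $T^{(n)}\in M_{a_n}(\mathbb C)$ of trace $1$, let $\omega_{\mathbf T}$ be the product state of $\mathcal A(a)$ with $$\omega_{\mathbf T}\big(E^{(a_1)}_{j_1,k_1}\otimes\cdots\otimes E^{(a_n)}_{j_n,k_n}\big)=T^{(1)}_{k_1,j_1}\cdots T^{(n)}_{k_n,j_n},$$ and let $\pi_{\mathbf T}$ be its GNS representation. **Theorem.** Let $\mathbf T=(T^{(n)})$ and $\mathbf R=(R^{(n)})$ be sequences of positive semidefinite matrices of trace $1$ with $T^{(n)}\in M_{a_n}(\mathbb C)$ and $R^{(n)}\in M_{b_n}(\mathbb C)$, and let $\mathbf T\boxtimes\mathbf R=(T^{(n)}\boxtimes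 R^{(n)})_{n\ge 1}$ be the sequence of Kronecker products, $(A\boxtimes B)_{m(i-1)+i',\,m(j-1)+j'}=A_{i,j}B_{i',j'}$ for $B\in M_m(\mathbb C)$. Then: (i) $\omega_{\mathbf T}\otimes_\varphi\omega_{\mathbf R}=\omega_{\mathbf T\boxtimes\mathbf R}$; (ii) $\pi_{\mathbf T}\otimes_\varphi\pi_{\mathbf R}$ is unitarily equivalent to $\pi_{\mathbf T\boxtimes\mathbf R}$. -/

import Mathlib

noncomputable section

namespace UHF

open UniformSpace
open scoped TensorProduct ComplexOrder

/-! ### C⋆-completions -/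

/-- A C⋆-seminorm on a complex ⋆-algebra. -/
structure CStarSeminorm (A : Type*) [Ring A] [StarRing A] [Algebra ℂ A] [StarModule ℂ A] where
  /-- the underlying seminorm -/
  toSeminorm : Seminorm ℂ A
  mul_le' : ∀ x y, toSeminorm (x * y) ≤ toSeminorm x * toSeminorm y
  le_star_mul_self' : ∀ x, toSeminorm x * toSeminorm x ≤ toSeminorm (star x * x)

namespace CStarSeminorm

variable {A : Type*} [Ring A] [StarRing A] [Algebra ℂ A] [StarModule ℂ A] (p : CStarSeminorm A)

/-- The algebra `A`, regarded as a seminormed algebra through `p`. -/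
def Space (_ : CStarSeminorm A) : Type _ := A

instance : Ring p.Space := inferInstanceAs (Ring A)
instance : StarRing p.Space := inferInstanceAs (StarRing A)
instance : Algebra ℂ p.Space := inferInstanceAs (Algebra ℂ A)
instance : StarModule ℂ p.Space := inferInstanceAs (StarModule ℂ A)

/-- The identity map from `A` to `p.Space`. -/
def toSpace : A ≃⋆ₐ[ℂ] p.Space := StarAlgEquiv.refl (R := ℂ) (A := A)

instance : SeminormedRing p.Space where
  __ := (inferInstance : Ring p.Space)
  __ := AddGroupSeminorm.toSeminormedAddCommGroup (E := p.Space) p.toSeminorm.toAddGroupSeminorm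
  norm_mul_le := p.mul_le'

lemma norm_toSpace (x : A) : ‖p.toSpace x‖ = p.toSeminorm x := rfl

instance : NormedAlgebra ℂ p.Space where
  norm_smul_le c x := by
    exact (map_smul_eq_mul p.toSeminorm c (p.toSpace.symm x)).le

lemma norm_mul_self_le (x : p.Space) : ‖x‖ * ‖x‖ ≤ ‖star x * x‖ := p.le_star_mul_self' x

lemma norm_star_le (x : p.Space) : ‖star x‖ ≤ ‖x‖ := by
  have h : ‖star x‖ * ‖star x‖ ≤ ‖x‖ * ‖star x‖ := by
    have h1 := p.norm_mul_self_le (star x)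
    rw [star_star] at h1
    exact h1.trans (norm_mul_le _ _)
  rcases (norm_nonneg (star x)).eq_or_lt with h0 | h0
  · rw [← h0]; exact norm_nonneg x
  · exact le_of_mul_le_mul_right h h0

instance : NormedStarGroup p.Space := ⟨p.norm_star_le⟩

instance : Star (Completion p.Space) := ⟨Completion.map (star : p.Space → p.Space)⟩

lemma uniformContinuous_star : UniformContinuous (star : p.Space → p.Space) :=
  (starₗᵢ ℂ (E := p.Space)).isometry.uniformContinuous

lemma star_coe (x : p.Space) : star (x : Completion p.Space) = ((star x : p.Space) : Completion p.Space) :=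
  Completion.map_coe p.uniformContinuous_star x

instance : ContinuousStar (Completion p.Space) := ⟨Completion.continuous_map⟩

instance : StarRing (Completion p.Space) where
  star_involutive x := by
    induction x using Completion.induction_on with
    | hp => apply isClosed_eq <;> fun_prop
    | ih x => simp [star_coe]
  star_mul x y := by
    induction x, y using Completion.induction_on₂ with
    | hp => apply isClosed_eq <;> fun_prop
    | ih x y => simp [star_coe, ← Completion.coe_mul]
  star_add x y := by
    induction x, y using Completion.induction_on₂ with
    | hp => apply isClosed_eq <;> fun_prop
    | ih x y => simp [star_coe, ← Completion.coe_add]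

instance : StarModule ℂ (Completion p.Space) where
  star_smul c x := by
    induction x using Completion.induction_on with
    | hp =>
      exact isClosed_eq (continuous_star.comp (continuous_const_smul c))
        (Continuous.const_smul continuous_star (star c))
    | ih x => simp [star_coe, ← Completion.coe_smul]

instance : CStarRing (Completion p.Space) where
  norm_mul_self_le x := by
    induction x using Completion.induction_on with
    | hp => apply isClosed_le <;> fun_prop
    | ih x => simpa [star_coe, ← Completion.coe_mul] using p.norm_mul_self_le x

instance : NormedAlgebra ℂ (Completion p.Space) where
  norm_smul_le := norm_smul_le

instance : CStarAlgebra (Completion p.Space) where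

/-- The canonical ⋆-homomorphism of `A` into its completion (auxiliary form). -/
def toComplAux : A →⋆ₐ[ℂ] Completion p.Space where
  toFun x := (p.toSpace x : Completion p.Space)
  map_one' := by simp [Completion.coe_one]
  map_mul' := by simp [Completion.coe_mul]
  map_zero' := by simp [Completion.coe_zero]
  map_add' := by simp [Completion.coe_add]
  commutes' c := by
    simp [Algebra.algebraMap_eq_smul_one, Completion.coe_one]
  map_star' x := by simp [star_coe, map_star]

/-- The C⋆-algebra obtained from `A` by completing it with respect to `p`
(the null space of `p` is divided out). -/
def Compl : Type _ := Completion p.Space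

instance : CStarAlgebra p.Compl := inferInstanceAs (CStarAlgebra (Completion p.Space))
instance : PartialOrder p.Compl := CStarAlgebra.spectralOrder p.Compl
instance : StarOrderedRing p.Compl := CStarAlgebra.spectralOrderedRing p.Compl

/-- The canonical ⋆-homomorphism of `A` into its completion. -/
def toCompl : A →⋆ₐ[ℂ] p.Compl := p.toComplAux

lemma norm_toCompl (x : A) : ‖p.toCompl x‖ = p.toSeminorm x :=
  Completion.norm_coe (p.toSpace x)

lemma denseRange_toCompl : DenseRange p.toCompl :=
  Completion.denseRange_coe.comp p.toSpace.surjective.denseRange (Completion.continuous_coe _)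

/-- The extension of a `p`-contractive linear map to the completion. -/
def extendL {E : Type*} [NormedAddCommGroup E] [NormedSpace ℂ E] [CompleteSpace E]
    (f : A →ₗ[ℂ] E) (hf : ∀ x, ‖f x‖ ≤ p.toSeminorm x) : p.Compl →L[ℂ] E :=
  ((f ∘ₗ (p.toSpace.symm : p.Space →ₗ[ℂ] A)).mkContinuous 1 (fun x => by
    rw [one_mul]; exact hf _)).fromCompletion

lemma extendL_toCompl {E : Type*} [NormedAddCommGroup E] [NormedSpace ℂ E] [CompleteSpace E]
    (f : A →ₗ[ℂ] E) (hf : ∀ x, ‖f x‖ ≤ p.toSeminorm x) (x : A) :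
    p.extendL f hf (p.toCompl x) = f x :=
  ContinuousLinearMap.fromCompletion_apply_coe
    ((f ∘ₗ (p.toSpace.symm : p.Space →ₗ[ℂ] A)).mkContinuous 1 (fun x => by
      rw [one_mul]; exact hf _)) (p.toSpace x)

/-- The extension of a `p`-contractive ⋆-homomorphism into a C⋆-algebra to the completion. -/
def extend {B : Type*} [CStarAlgebra B] (f : A →⋆ₐ[ℂ] B) (hf : ∀ x, ‖f x‖ ≤ p.toSeminorm x) :
    p.Compl →⋆ₐ[ℂ] B :=
  let F := p.extendL (f : A →ₐ[ℂ] B).toLinearMap hf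
  have hF (x : A) : F (p.toCompl x) = f x := p.extendL_toCompl _ hf x
  have h1 : F 1 = 1 := by rw [← map_one p.toCompl, hF, map_one]
  { toFun := F
    map_one' := h1
    map_mul' x y := by
      refine p.denseRange_toCompl.induction_on₂ (p := fun x y => F (x * y) = F x * F y)
        (isClosed_eq (by fun_prop) (by fun_prop)) (fun a b => ?_) x y
      rw [← map_mul, hF, hF, hF, map_mul]
    map_zero' := map_zero F
    map_add' := map_add F
    commutes' c := by
      rw [Algebra.algebraMap_eq_smul_one, map_smul, h1, Algebra.algebraMap_eq_smul_one]
    map_star' x := by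
      refine p.denseRange_toCompl.induction_on (p := fun x => F (star x) = star (F x)) x
        (isClosed_eq (by fun_prop) (by fun_prop)) (fun a => ?_)
      rw [← map_star, hF, hF, map_star] }

lemma extend_toCompl {B : Type*} [CStarAlgebra B] (f : A →⋆ₐ[ℂ] B)
    (hf : ∀ x, ‖f x‖ ≤ p.toSeminorm x) (x : A) : p.extend f hf (p.toCompl x) = f x :=
  p.extendL_toCompl _ hf x

end CStarSeminorm

/-! ### States -/

/-- States of a unital C⋆-algebra: positive linear functionals `f` with `f 1 = 1`. -/
structure State (A : Type*) [CStarAlgebra A] [PartialOrder A] [StarOrderedRing A] where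
  /-- the underlying positive linear functional -/
  toPositive : A →ₚ[ℂ] ℂ
  map_one' : toPositive 1 = 1

namespace State

section
variable {A : Type*} [CStarAlgebra A] [PartialOrder A] [StarOrderedRing A] (f : State A)

/-- The GNS Hilbert space of a state. -/
abbrev GNS : Type _ := f.toPositive.GNS

/-- The GNS representation of a state. -/
abbrev gnsRep : A →⋆ₐ[ℂ] (f.GNS →L[ℂ] f.GNS) := f.toPositive.gnsStarAlgHom

/-- The cyclic vector of the GNS representation. -/
def gnsVector : f.GNS := ((f.toPositive.toPreGNS 1 : f.toPositive.PreGNS) : f.GNS)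

lemma inner_gnsVector (x : A) :
    inner ℂ f.gnsVector (f.gnsRep x f.gnsVector) = f.toPositive x := by
  change inner ℂ f.gnsVector (f.toPositive.gnsNonUnitalStarAlgHom x _) = _
  rw [gnsVector, PositiveLinearMap.gnsNonUnitalStarAlgHom_apply_coe, Completion.inner_coe,
    PositiveLinearMap.preGNS_inner_def]
  simp

lemma norm_gnsVector : ‖f.gnsVector‖ = 1 := by
  have h := f.inner_gnsVector 1
  rw [map_one, f.map_one', one_apply_eq_self, inner_self_eq_norm_sq_to_K] at h
  have h' : ‖f.gnsVector‖ ^ 2 = 1 := Complex.ofReal_injective (by simpa using h)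
  exact (pow_eq_one_iff_of_nonneg (norm_nonneg _) two_ne_zero).mp h'

lemma norm_apply_le (x : A) : ‖f.toPositive x‖ ≤ ‖x‖ := by
  rw [← f.inner_gnsVector]
  refine (norm_inner_le_norm _ _).trans ?_
  rw [norm_gnsVector, one_mul]
  refine ((f.gnsRep x).le_opNorm _).trans ?_
  rw [norm_gnsVector, mul_one]
  exact NonUnitalStarAlgHom.norm_apply_le f.gnsRep x

end

/-- The vector state `x ↦ ⟪v, π(x) v⟫` of a representation `π` and a unit vector `v`. -/
def ofVector {A : Type*} [CStarAlgebra A] [PartialOrder A] [StarOrderedRing A]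
    {H : Type*} [NormedAddCommGroup H] [InnerProductSpace ℂ H] [CompleteSpace H]
    (π : A →⋆ₐ[ℂ] (H →L[ℂ] H)) (v : H) (hv : ‖v‖ = 1) : State A where
  toPositive := .mk₀
    { toFun := fun x => inner ℂ v (π x v)
      map_add' := fun x y => by simp
      map_smul' := fun c x => by simp }
    (fun x hx => by
      obtain ⟨y, rfl⟩ := CStarAlgebra.nonneg_iff_eq_star_mul_self.mp hx
      change 0 ≤ inner ℂ v (π (star y * y) v)
      rw [map_mul, map_star, mul_apply_eq_comp, ContinuousLinearMap.star_eq_adjoint,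
        ContinuousLinearMap.adjoint_inner_right, inner_self_eq_norm_sq_to_K]
      exact pow_nonneg (Complex.zero_le_real.mpr (norm_nonneg (π y v))) 2)
  map_one' := by
    change inner ℂ v (π 1 v) = 1
    rw [map_one, one_apply_eq_self, inner_self_eq_norm_sq_to_K, hv]
    simp

/-- The pull-back `f ∘ φ` of a state along a unital ⋆-homomorphism. -/
def comp {A B : Type*} [CStarAlgebra A] [PartialOrder A] [StarOrderedRing A]
    [CStarAlgebra B] [PartialOrder B] [StarOrderedRing B] (f : State B) (φ : A →⋆ₐ[ℂ] B) :
    State A where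
  toPositive := .mk₀ (f.toPositive.toLinearMap ∘ₗ (φ : A →ₐ[ℂ] B).toLinearMap) (fun x hx => by
    obtain ⟨y, rfl⟩ := CStarAlgebra.nonneg_iff_eq_star_mul_self.mp hx
    change 0 ≤ f.toPositive (φ (star y * y))
    rw [map_mul, map_star]
    exact f.toPositive.map_nonneg (star_mul_self_nonneg _))
  map_one' := by
    change f.toPositive (φ 1) = 1
    rw [map_one, f.map_one']

lemma comp_apply {A B : Type*} [CStarAlgebra A] [PartialOrder A] [StarOrderedRing A]
    [CStarAlgebra B] [PartialOrder B] [StarOrderedRing B] (f : State B) (φ : A →⋆ₐ[ℂ] B) (x : A) :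
    (f.comp φ).toPositive x = f.toPositive (φ x) := rfl

/-- The extension to the C⋆-completion of a normalized functional on a ⋆-algebra that is
positive and contractive. -/
def extend {A : Type*} [Ring A] [StarRing A] [Algebra ℂ A] [StarModule ℂ A] (p : CStarSeminorm A)
    (f : A →ₗ[ℂ] ℂ) (h1 : f 1 = 1) (hpos : ∀ x, 0 ≤ f (star x * x))
    (hf : ∀ x, ‖f x‖ ≤ p.toSeminorm x) : State p.Compl where
  toPositive := .mk₀ (p.extendL f hf).toLinearMap (fun x hx => by
    obtain ⟨y, rfl⟩ := CStarAlgebra.nonneg_iff_eq_star_mul_self.mp hx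
    refine p.denseRange_toCompl.induction_on (p := fun y => 0 ≤ p.extendL f hf (star y * y)) y
      (isClosed_le (by fun_prop) (by fun_prop)) (fun a => ?_)
    rw [← map_star, ← map_mul, CStarSeminorm.extendL_toCompl]
    exact hpos a)
  map_one' := by
    change p.extendL f hf 1 = 1
    rw [← map_one p.toCompl, CStarSeminorm.extendL_toCompl, h1]

lemma extend_toCompl {A : Type*} [Ring A] [StarRing A] [Algebra ℂ A] [StarModule ℂ A]
    (p : CStarSeminorm A) (f : A →ₗ[ℂ] ℂ) (h1 : f 1 = 1) (hpos : ∀ x, 0 ≤ f (star x * x))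
    (hf : ∀ x, ‖f x‖ ≤ p.toSeminorm x) (x : A) :
    (extend p f h1 hpos hf).toPositive (p.toCompl x) = f x :=
  p.extendL_toCompl f hf x

end State

/-! ### Tensor products -/

/-- The Hilbert space tensor product: the completion of the algebraic tensor product with
`⟪x ⊗ y, x' ⊗ y'⟫ = ⟪x, x'⟫ * ⟪y, y'⟫`. -/
def HilbertTensor (H K : Type*) [NormedAddCommGroup H] [InnerProductSpace ℂ H]
    [NormedAddCommGroup K] [InnerProductSpace ℂ K] : Type _ :=
  Completion (H ⊗[ℂ] K)

section
variable {H K : Type*} [NormedAddCommGroup H] [InnerProductSpace ℂ H]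
    [NormedAddCommGroup K] [InnerProductSpace ℂ K]

instance : NormedAddCommGroup (HilbertTensor H K) :=
  inferInstanceAs (NormedAddCommGroup (Completion (H ⊗[ℂ] K)))
instance : InnerProductSpace ℂ (HilbertTensor H K) :=
  inferInstanceAs (InnerProductSpace ℂ (Completion (H ⊗[ℂ] K)))
instance : CompleteSpace (HilbertTensor H K) :=
  inferInstanceAs (CompleteSpace (Completion (H ⊗[ℂ] K)))

variable (H K) in
/-- The inclusion of the algebraic tensor product. -/
def ofAlg : H ⊗[ℂ] K →ₗᵢ[ℂ] HilbertTensor H K := Completion.toComplₗᵢ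

lemma denseRange_ofAlg : DenseRange (ofAlg H K) :=
  Completion.denseRange_coe (α := H ⊗[ℂ] K)

/-- The elementary tensor of two vectors. -/
def htmul (x : H) (y : K) : HilbertTensor H K := ofAlg H K (x ⊗ₜ y)

lemma inner_htmul (x x' : H) (y y' : K) :
    inner ℂ (htmul x y) (htmul x' y') = inner ℂ x x' * inner ℂ y y' := by
  rw [htmul, htmul, LinearIsometry.inner_map_map, TensorProduct.inner_tmul]

/-- The tensor product `S ⊗ T` of two bounded operators on the Hilbert space tensor product. -/
def opTensor (S : H →L[ℂ] H) (T : K →L[ℂ] K) : HilbertTensor H K →L[ℂ] HilbertTensor H K :=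
  (TensorProduct.mapL S T).completion

lemma opTensor_ofAlg (S : H →L[ℂ] H) (T : K →L[ℂ] K) (x : H ⊗[ℂ] K) :
    opTensor S T (ofAlg H K x) = ofAlg H K (TensorProduct.mapL S T x) :=
  ContinuousLinearMap.completion_apply_coe _ _

lemma opTensor_htmul (S : H →L[ℂ] H) (T : K →L[ℂ] K) (x : H) (y : K) :
    opTensor S T (htmul x y) = htmul (S x) (T y) := by
  rw [htmul, opTensor_ofAlg]; rfl

lemma op_ext {S T : HilbertTensor H K →L[ℂ] HilbertTensor H K}
    (h : ∀ (x : H) (y : K), S (htmul x y) = T (htmul x y)) : S = T := by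
  ext z
  refine denseRange_ofAlg.induction_on (p := fun z => S z = T z) z
    (isClosed_eq S.continuous T.continuous) fun z => ?_
  induction z with
  | zero => rw [map_zero, map_zero, map_zero]
  | add a b ha hb => rw [map_add, map_add, map_add, ha, hb]
  | tmul x y => exact h x y

lemma opTensor_mul (S S' : H →L[ℂ] H) (T T' : K →L[ℂ] K) :
    opTensor (S * S') (T * T') = opTensor S T * opTensor S' T' :=
  op_ext fun x y => by simp [opTensor_htmul]

lemma opTensor_one : opTensor (1 : H →L[ℂ] H) (1 : K →L[ℂ] K) = 1 :=
  op_ext fun x y => by simp [opTensor_htmul]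

lemma norm_opTensor_le (S : H →L[ℂ] H) (T : K →L[ℂ] K) : ‖opTensor S T‖ ≤ ‖S‖ * ‖T‖ := by
  refine ContinuousLinearMap.opNorm_le_bound _ (by positivity) fun z => ?_
  refine denseRange_ofAlg.induction_on (p := fun z => ‖opTensor S T z‖ ≤ ‖S‖ * ‖T‖ * ‖z‖) z
    (isClosed_le (by fun_prop) (by fun_prop)) fun z => ?_
  rw [opTensor_ofAlg, LinearIsometry.norm_map, LinearIsometry.norm_map]
  exact ((TensorProduct.mapL S T).le_opNorm z).trans
    (by gcongr; exact TensorProduct.norm_mapL_le S T)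

lemma star_opTensor [CompleteSpace H] [CompleteSpace K] (S : H →L[ℂ] H) (T : K →L[ℂ] K) :
    star (opTensor S T) = opTensor (star S) (star T) := by
  symm
  rw [ContinuousLinearMap.star_eq_adjoint (opTensor S T), ContinuousLinearMap.eq_adjoint_iff]
  intro x y
  refine denseRange_ofAlg.induction_on₂
    (p := fun x y => inner ℂ (opTensor (star S) (star T) x) y = inner ℂ x (opTensor S T y))
    (isClosed_eq (by fun_prop) (by fun_prop)) (fun x y => ?_) x y
  rw [opTensor_ofAlg, opTensor_ofAlg, LinearIsometry.inner_map_map, LinearIsometry.inner_map_map]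
  induction x with
  | zero => simp
  | add a b ha hb => rw [map_add, inner_add_left, inner_add_left, ha, hb]
  | tmul a b =>
    induction y with
    | zero => simp
    | add c d hc hd => rw [map_add, inner_add_right, inner_add_right, hc, hd]
    | tmul c d =>
      simp [ContinuousLinearMap.star_eq_adjoint, ContinuousLinearMap.adjoint_inner_left]

lemma htmul_add_left (x x' : H) (y : K) : htmul (x + x') y = htmul x y + htmul x' y := by
  simp [htmul, TensorProduct.add_tmul]

lemma htmul_add_right (x : H) (y y' : K) : htmul x (y + y') = htmul x y + htmul x y' := by
  simp [htmul, TensorProduct.tmul_add]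

lemma htmul_smul_left (c : ℂ) (x : H) (y : K) : htmul (c • x) y = c • htmul x y := by
  simp [htmul, ← TensorProduct.smul_tmul']

lemma htmul_smul_right (c : ℂ) (x : H) (y : K) : htmul x (c • y) = c • htmul x y := by
  simp [htmul]

/-- `(S, T) ↦ S ⊗ T` as a bilinear map. -/
def opTensorBilin : (H →L[ℂ] H) →ₗ[ℂ] (K →L[ℂ] K) →ₗ[ℂ]
    (HilbertTensor H K →L[ℂ] HilbertTensor H K) :=
  LinearMap.mk₂ ℂ opTensor
    (fun _ _ _ => op_ext fun _ _ => by simp [opTensor_htmul, htmul_add_left])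
    (fun _ _ _ => op_ext fun _ _ => by simp [opTensor_htmul, htmul_smul_left])
    (fun _ _ _ => op_ext fun _ _ => by simp [opTensor_htmul, htmul_add_right])
    (fun _ _ _ => op_ext fun _ _ => by simp [opTensor_htmul, htmul_smul_right])

end

universe u

section
variable {A B : Type*} [CStarAlgebra A] [CStarAlgebra B]

variable {H K : Type*} [NormedAddCommGroup H] [InnerProductSpace ℂ H] [CompleteSpace H]
    [NormedAddCommGroup K] [InnerProductSpace ℂ K] [CompleteSpace K]
    (π : A →⋆ₐ[ℂ] (H →L[ℂ] H)) (ρ : B →⋆ₐ[ℂ] (K →L[ℂ] K))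

/-- The linear map underlying `algRepTensor`. -/
def algRepTensorL : A ⊗[ℂ] B →ₗ[ℂ] (HilbertTensor H K →L[ℂ] HilbertTensor H K) :=
  TensorProduct.lift (opTensorBilin.compl₁₂ (π : A →ₐ[ℂ] (H →L[ℂ] H)).toLinearMap
    (ρ : B →ₐ[ℂ] (K →L[ℂ] K)).toLinearMap)

lemma algRepTensorL_tmul (a : A) (b : B) :
    algRepTensorL π ρ (a ⊗ₜ b) = opTensor (π a) (ρ b) := rfl

/-- The representation `a ⊗ b ↦ π(a) ⊗ ρ(b)` of the algebraic tensor product. -/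
def algRepTensor : A ⊗[ℂ] B →⋆ₐ[ℂ] (HilbertTensor H K →L[ℂ] HilbertTensor H K) :=
  { Algebra.TensorProduct.algHomOfLinearMapTensorProduct (algRepTensorL π ρ)
      (fun a₁ a₂ b₁ b₂ => by
        rw [algRepTensorL_tmul, algRepTensorL_tmul, algRepTensorL_tmul, map_mul, map_mul,
          opTensor_mul])
      (by rw [algRepTensorL_tmul, map_one, map_one, opTensor_one]) with
    map_star' := fun x => by
      change algRepTensorL π ρ (star x) = star (algRepTensorL π ρ x)
      induction x with
      | zero => rw [star_zero, map_zero, star_zero]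
      | add x y hx hy => rw [star_add, map_add, map_add, star_add, hx, hy]
      | tmul a b =>
        rw [TensorProduct.star_tmul, algRepTensorL_tmul, algRepTensorL_tmul, star_opTensor,
          map_star, map_star] }

lemma algRepTensor_tmul (a : A) (b : B) :
    algRepTensor π ρ (a ⊗ₜ b) = opTensor (π a) (ρ b) := rfl

end

section
variable (A B : Type u) [CStarAlgebra A] [CStarAlgebra B]

variable {A B} in
/-- The norms of `(π ⊗ ρ)(x)`, where `π` and `ρ` run over all representations of `A` and `B`
on Hilbert spaces. -/
def repNorms (x : A ⊗[ℂ] B) : Set ℝ :=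
  {r | ∃ (H : Type u) (_ : NormedAddCommGroup H) (_ : InnerProductSpace ℂ H) (_ : CompleteSpace H)
    (K : Type u) (_ : NormedAddCommGroup K) (_ : InnerProductSpace ℂ K) (_ : CompleteSpace K)
    (π : A →⋆ₐ[ℂ] (H →L[ℂ] H)) (ρ : B →⋆ₐ[ℂ] (K →L[ℂ] K)), r = ‖algRepTensor π ρ x‖}

variable {A B}

lemma bddAbove_repNorms (x : A ⊗[ℂ] B) : BddAbove (repNorms x) := by
  induction x with
  | zero => exact ⟨0, by rintro r ⟨H, _, _, _, K, _, _, _, π, ρ, rfl⟩; simp⟩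
  | add x y hx hy =>
    obtain ⟨c, hc⟩ := hx
    obtain ⟨d, hd⟩ := hy
    refine ⟨c + d, ?_⟩
    rintro r ⟨H, _, _, _, K, _, _, _, π, ρ, rfl⟩
    rw [map_add]
    exact (norm_add_le _ _).trans (add_le_add (hc ⟨H, _, _, _, K, _, _, _, π, ρ, rfl⟩)
      (hd ⟨H, _, _, _, K, _, _, _, π, ρ, rfl⟩))
  | tmul a b =>
    refine ⟨‖a‖ * ‖b‖, ?_⟩
    rintro r ⟨H, _, _, _, K, _, _, _, π, ρ, rfl⟩
    rw [algRepTensor_tmul]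
    refine (norm_opTensor_le _ _).trans ?_
    gcongr
    · exact NonUnitalStarAlgHom.norm_apply_le π a
    · exact NonUnitalStarAlgHom.norm_apply_le ρ b

lemma norm_algRepTensor_le {H K : Type u}
    [NormedAddCommGroup H] [InnerProductSpace ℂ H] [CompleteSpace H]
    [NormedAddCommGroup K] [InnerProductSpace ℂ K] [CompleteSpace K]
    (π : A →⋆ₐ[ℂ] (H →L[ℂ] H)) (ρ : B →⋆ₐ[ℂ] (K →L[ℂ] K)) (x : A ⊗[ℂ] B) :
    ‖algRepTensor π ρ x‖ ≤ sSup (repNorms x) :=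
  le_csSup (bddAbove_repNorms x) ⟨H, _, _, _, K, _, _, _, π, ρ, rfl⟩

lemma sSup_repNorms_nonneg (x : A ⊗[ℂ] B) : 0 ≤ sSup (repNorms x) := by
  refine Real.sSup_nonneg ?_
  rintro r ⟨H, _, _, _, K, _, _, _, π, ρ, rfl⟩
  exact norm_nonneg _

lemma sSup_repNorms_le {x : A ⊗[ℂ] B} {c : ℝ} (hc : 0 ≤ c)
    (h : ∀ (H : Type u) [NormedAddCommGroup H] [InnerProductSpace ℂ H] [CompleteSpace H]
      (K : Type u) [NormedAddCommGroup K] [InnerProductSpace ℂ K] [CompleteSpace K]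
      (π : A →⋆ₐ[ℂ] (H →L[ℂ] H)) (ρ : B →⋆ₐ[ℂ] (K →L[ℂ] K)), ‖algRepTensor π ρ x‖ ≤ c) :
    sSup (repNorms x) ≤ c := by
  refine Real.sSup_le ?_ hc
  rintro r ⟨H, _, _, _, K, _, _, _, π, ρ, rfl⟩
  exact h H K π ρ

variable (A B) in
/-- The minimal (spatial) C⋆-norm on the algebraic tensor product: the supremum of
`‖(π ⊗ ρ)(x)‖` over all representations `π` of `A` and `ρ` of `B`. -/
def minNorm : CStarSeminorm (A ⊗[ℂ] B) where
  toSeminorm := Seminorm.ofSMulLE (fun x => sSup (repNorms x))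
    (le_antisymm (sSup_repNorms_le le_rfl fun H _ _ _ K _ _ _ π ρ => by simp)
      (sSup_repNorms_nonneg _))
    (fun x y => sSup_repNorms_le
      (add_nonneg (sSup_repNorms_nonneg _) (sSup_repNorms_nonneg _))
      fun H _ _ _ K _ _ _ π ρ => by
        rw [map_add]
        exact (norm_add_le _ _).trans
          (add_le_add (norm_algRepTensor_le π ρ x) (norm_algRepTensor_le π ρ y)))
    (fun c x => sSup_repNorms_le (mul_nonneg (norm_nonneg _) (sSup_repNorms_nonneg _))
      fun H _ _ _ K _ _ _ π ρ => by
        rw [map_smul, norm_smul]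
        exact mul_le_mul_of_nonneg_left (norm_algRepTensor_le π ρ x) (norm_nonneg _))
  mul_le' x y := sSup_repNorms_le
    (mul_nonneg (sSup_repNorms_nonneg _) (sSup_repNorms_nonneg _))
    fun H _ _ _ K _ _ _ π ρ => by
      rw [map_mul]
      exact (norm_mul_le _ _).trans (mul_le_mul (norm_algRepTensor_le π ρ x)
        (norm_algRepTensor_le π ρ y) (norm_nonneg _) (sSup_repNorms_nonneg _))
  le_star_mul_self' x := by
    change sSup (repNorms x) * sSup (repNorms x) ≤ sSup (repNorms (star x * x))
    have h : sSup (repNorms x) ≤ Real.sqrt (sSup (repNorms (star x * x))) := by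
      refine sSup_repNorms_le (Real.sqrt_nonneg _) fun H _ _ _ K _ _ _ π ρ => ?_
      refine Real.le_sqrt_of_sq_le ?_
      rw [sq, ← CStarRing.norm_star_mul_self, ← map_star, ← map_mul]
      exact norm_algRepTensor_le π ρ _
    calc _ ≤ Real.sqrt (sSup (repNorms (star x * x))) * Real.sqrt (sSup (repNorms (star x * x))) :=
          mul_self_le_mul_self (sSup_repNorms_nonneg _) h
      _ = _ := Real.mul_self_sqrt (sSup_repNorms_nonneg _)

variable (A B) in
/-- The minimal C⋆-tensor product of two unital C⋆-algebras. -/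
abbrev MinTensor : Type u := (minNorm A B).Compl

/-- The elementary tensor `a ⊗ b` in the minimal tensor product. -/
def minTmul (a : A) (b : B) : MinTensor A B := (minNorm A B).toCompl (a ⊗ₜ b)

lemma norm_minTmul_le (a : A) (b : B) : ‖minTmul a b‖ ≤ ‖a‖ * ‖b‖ := by
  rw [minTmul, CStarSeminorm.norm_toCompl]
  refine sSup_repNorms_le (by positivity) fun H _ _ _ K _ _ _ π ρ => ?_
  rw [algRepTensor_tmul]
  exact (norm_opTensor_le _ _).trans (mul_le_mul (NonUnitalStarAlgHom.norm_apply_le π a)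
    (NonUnitalStarAlgHom.norm_apply_le ρ b) (norm_nonneg _) (norm_nonneg _))

lemma continuous_minTmul : Continuous fun z : A × B => minTmul z.1 z.2 := by
  let L : A →ₗ[ℂ] B →ₗ[ℂ] MinTensor A B :=
    (TensorProduct.mk ℂ A B).compr₂ (minNorm A B).toCompl.toAlgHom.toLinearMap
  exact (L.mkContinuous₂ 1 fun a b => by
    rw [one_mul]; exact norm_minTmul_le a b).continuous₂

/-- The tensor product `π ⊗ ρ` of two representations, as a representation of the minimal tensor
product on the Hilbert space tensor product. -/
def repTensor {H K : Type u} [NormedAddCommGroup H] [InnerProductSpace ℂ H] [CompleteSpace H]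
    [NormedAddCommGroup K] [InnerProductSpace ℂ K] [CompleteSpace K]
    (π : A →⋆ₐ[ℂ] (H →L[ℂ] H)) (ρ : B →⋆ₐ[ℂ] (K →L[ℂ] K)) :
    MinTensor A B →⋆ₐ[ℂ] (HilbertTensor H K →L[ℂ] HilbertTensor H K) :=
  (minNorm A B).extend (algRepTensor π ρ) (norm_algRepTensor_le π ρ)

lemma repTensor_minTmul {H K : Type u}
    [NormedAddCommGroup H] [InnerProductSpace ℂ H] [CompleteSpace H]
    [NormedAddCommGroup K] [InnerProductSpace ℂ K] [CompleteSpace K]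
    (π : A →⋆ₐ[ℂ] (H →L[ℂ] H)) (ρ : B →⋆ₐ[ℂ] (K →L[ℂ] K)) (a : A) (b : B) :
    repTensor π ρ (minTmul a b) = opTensor (π a) (ρ b) := by
  exact (minNorm A B).extend_toCompl (algRepTensor π ρ) _ (a ⊗ₜ b)

variable [PartialOrder A] [StarOrderedRing A] [PartialOrder B] [StarOrderedRing B]

/-- The tensor product `f ⊗ g` of two states: the state of the minimal tensor product
with `(f ⊗ g)(a ⊗ b) = f(a) g(b)`, obtained as a vector state of the tensor product of the
GNS representations. -/
def stateTensor (f : State A) (g : State B) : State (MinTensor A B) :=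
  .ofVector (repTensor f.gnsRep g.gnsRep)
    (htmul f.gnsVector g.gnsVector)
    (by rw [htmul, LinearIsometry.norm_map, TensorProduct.norm_tmul, f.norm_gnsVector,
      g.norm_gnsVector, mul_one])

lemma stateTensor_minTmul (f : State A) (g : State B) (a : A) (b : B) :
    (stateTensor f g).toPositive (minTmul a b) = f.toPositive a * g.toPositive b := by
  change inner ℂ _ (repTensor f.gnsRep g.gnsRep (minTmul a b) _) = _
  rw [repTensor_minTmul, opTensor_htmul, inner_htmul,
    f.inner_gnsVector, g.inner_gnsVector]

end

/-- Unitary equivalence of representations on Hilbert spaces. -/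
def UnitarilyEquivalent {A : Type*} [CStarAlgebra A]
    {H K : Type*} [NormedAddCommGroup H] [InnerProductSpace ℂ H] [CompleteSpace H]
    [NormedAddCommGroup K] [InnerProductSpace ℂ K] [CompleteSpace K]
    (π : A →⋆ₐ[ℂ] (H →L[ℂ] H)) (ρ : A →⋆ₐ[ℂ] (K →L[ℂ] K)) : Prop :=
  ∃ U : H ≃ₗᵢ[ℂ] K, ∀ (x : A) (ξ : H), U (π x ξ) = ρ x (U ξ)

/-! ### UHF algebras -/

section UHFAlgebras
open scoped Kronecker Matrix.Norms.L2Operator MatrixOrder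

/-- Sequences of integers `≥ 2` (indexed from `0`). -/
abbrev Seq2 : Type := {a : ℕ → ℕ // ∀ n, 2 ≤ a n}

/-- The componentwise product of sequences. -/
instance : Mul Seq2 :=
  ⟨fun a b => ⟨fun n => a.1 n * b.1 n, fun n => (Nat.le_mul_of_pos_right 2
    (two_pos.trans_le (b.2 n))).trans (Nat.mul_le_mul_right _ (a.2 n))⟩⟩

variable (a b : Seq2)

instance (n : ℕ) : NeZero (a.1 n) := ⟨(two_pos.trans_le (a.2 n)).ne'⟩

/-- Multi-indices of length `n`, the index set of the matrix units `E_{J,K}` of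
`M_{a 0} ⊗ ⋯ ⊗ M_{a (n-1)}`. -/
abbrev Idx (n : ℕ) : Type := (i : Fin n) → Fin (a.1 i)

/-- `M_{a 0} ⊗ ⋯ ⊗ M_{a (n-1)}`, as the algebra of matrices indexed by multi-indices. -/
abbrev Mat (n : ℕ) : Type := Matrix (Idx a n) (Idx a n) ℂ

/-- Splitting off the last component of a multi-index. -/
def splitLast (n : ℕ) : Idx a (n + 1) ≃ Idx a n × Fin (a.1 n) :=
  (Fin.snocEquiv (fun i : Fin (n + 1) => Fin (a.1 i))).symm.trans (Equiv.prodComm _ _)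

lemma splitLast_apply (n : ℕ) (x : Idx a (n + 1)) :
    splitLast a n x = (fun i : Fin n => x (Fin.castSucc i), x (Fin.last n)) := rfl

/-- The embedding `x ↦ x ⊗ 1` of `Mat a n` into `Mat a (n + 1)`. -/
def psi (n : ℕ) : Mat a n →⋆ₐ[ℂ] Mat a (n + 1) where
  toFun x := (x ⊗ₖ (1 : Matrix (Fin (a.1 n)) (Fin (a.1 n)) ℂ)).submatrix
    (splitLast a n) (splitLast a n)
  map_one' := by simp
  map_mul' x y := by
    rw [Matrix.submatrix_mul_equiv, ← Matrix.mul_kronecker_mul, one_mul]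
  map_zero' := by simp
  map_add' x y := by simp [Matrix.add_kronecker, Matrix.submatrix_add]
  commutes' c := by
    simp [Algebra.algebraMap_eq_smul_one, Matrix.smul_kronecker, Matrix.submatrix_smul]
  map_star' x := by
    simp [Matrix.star_eq_conjTranspose, Matrix.conjTranspose_kronecker]

lemma psi_apply (n : ℕ) (x : Mat a n) : psi a n x =
    (x ⊗ₖ (1 : Matrix (Fin (a.1 n)) (Fin (a.1 n)) ℂ)).submatrix
      (splitLast a n) (splitLast a n) := rfl

lemma psi_injective (n : ℕ) : Function.Injective (psi a n) := by
  intro x y h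
  ext i j
  have := congrFun (congrFun h ((splitLast a n).symm (i, 0))) ((splitLast a n).symm (j, 0))
  simpa [psi_apply] using this

/-- The composite embedding of `Mat a m` into `Mat a n` for `m ≤ n`. -/
def psiLE (m n : ℕ) (h : m ≤ n) : Mat a m →⋆ₐ[ℂ] Mat a n :=
  Nat.leRecOn (C := fun k => Mat a m →⋆ₐ[ℂ] Mat a k) h (fun {k} f => (psi a k).comp f)
    (StarAlgHom.id ℂ (Mat a m))

lemma psiLE_self (n : ℕ) (x : Mat a n) : psiLE a n n le_rfl x = x := by
  rw [psiLE, Nat.leRecOn_self]; rfl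

lemma psiLE_succ {m n : ℕ} (h : m ≤ n) (x : Mat a m) :
    psiLE a m (n + 1) (h.trans n.le_succ) x = psi a n (psiLE a m n h x) := by
  rw [psiLE, Nat.leRecOn_succ h]; rfl

instance : DirectedSystem (Mat a) (fun m n h => ⇑(psiLE a m n h)) where
  map_self n x := psiLE_self a n x
  map_map {m n k} hmn hnk x := by
    induction hnk with
    | refl => rw [psiLE_self]
    | step h ih => rw [psiLE_succ a h, psiLE_succ a (hmn.trans h), ih]

lemma psiLE_injective {m n : ℕ} (h : m ≤ n) : Function.Injective (psiLE a m n h) := by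
  induction h with
  | refl => intro x y h; simpa [psiLE_self] using h
  | step h ih =>
    intro x y hxy
    rw [psiLE_succ a h, psiLE_succ a h] at hxy
    exact ih (psi_injective a _ hxy)

/-- The algebraic inductive limit of the matrix algebras `Mat a n`. -/
abbrev AlgLim : Type := DirectLimit (Mat a) (psiLE a)

/-- The canonical embedding of `Mat a n` into the algebraic inductive limit. -/
def toAlgLim (n : ℕ) : Mat a n →⋆ₐ[ℂ] AlgLim a :=
  { DirectLimit.Algebra.of (Mat a) (psiLE a) n with map_star' := fun _ => rfl }

lemma toAlgLim_psi (n : ℕ) (x : Mat a n) : toAlgLim a (n + 1) (psi a n x) = toAlgLim a n x := by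
  have h := DirectLimit.Algebra.of_f (R := ℂ) (G := Mat a) (f := psiLE a) n.le_succ x
  have h' := psiLE_succ a (le_refl n) x
  rw [psiLE_self] at h'
  rw [← h']
  exact h

lemma exists_toAlgLim (x : AlgLim a) : ∃ n y, x = toAlgLim a n y :=
  DirectLimit.exists_eq_mk (psiLE a) x

lemma exists_toAlgLim₂ (x y : AlgLim a) :
    ∃ n x' y', x = toAlgLim a n x' ∧ y = toAlgLim a n y' :=
  DirectLimit.exists_eq_mk₂ (psiLE a) x y

lemma psiLE_compat {X : Type*} (g : ∀ n, Mat a n → X) (hg : ∀ n x, g (n + 1) (psi a n x) = g n x)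
    (m n : ℕ) (h : m ≤ n) (x : Mat a m) : g n (psiLE a m n h x) = g m x := by
  induction h with
  | refl => rw [psiLE_self]
  | step h ih => rw [psiLE_succ a h, hg, ih]

/-- The norm of the inductive limit, which restricts to the operator norm on each `Mat a n`. -/
def limNorm (x : AlgLim a) : ℝ :=
  DirectLimit.lift (psiLE a · · ·) (fun _ (x : Mat a _) => ‖x‖)
    (fun m n h x => (NonUnitalStarAlgHom.norm_map (psiLE a m n h) (psiLE_injective a h) x).symm) x

lemma limNorm_toAlgLim (n : ℕ) (x : Mat a n) : limNorm a (toAlgLim a n x) = ‖x‖ := rfl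

/-- The C⋆-norm on the algebraic inductive limit. -/
def limCStarNorm : CStarSeminorm (AlgLim a) where
  toSeminorm := Seminorm.ofSMulLE (limNorm a)
    (by rw [← map_zero (toAlgLim a 0), limNorm_toAlgLim, norm_zero])
    (fun x y => by
      obtain ⟨n, x, y, rfl, rfl⟩ := exists_toAlgLim₂ a x y
      rw [← map_add, limNorm_toAlgLim, limNorm_toAlgLim, limNorm_toAlgLim]
      exact norm_add_le x y)
    (fun c x => by
      obtain ⟨n, x, rfl⟩ := exists_toAlgLim a x
      rw [← map_smul, limNorm_toAlgLim, limNorm_toAlgLim]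
      exact norm_smul_le c x)
  mul_le' x y := by
    change limNorm a (x * y) ≤ limNorm a x * limNorm a y
    obtain ⟨n, x, y, rfl, rfl⟩ := exists_toAlgLim₂ a x y
    rw [← map_mul, limNorm_toAlgLim, limNorm_toAlgLim, limNorm_toAlgLim]
    exact norm_mul_le x y
  le_star_mul_self' x := by
    change limNorm a x * limNorm a x ≤ limNorm a (star x * x)
    obtain ⟨n, x, rfl⟩ := exists_toAlgLim a x
    rw [← map_star, ← map_mul, limNorm_toAlgLim, limNorm_toAlgLim]
    exact CStarRing.norm_mul_self_le x

lemma limCStarNorm_toAlgLim (n : ℕ) (x : Mat a n) :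
    (limCStarNorm a).toSeminorm (toAlgLim a n x) = ‖x‖ := rfl

/-- The UHF algebra of the sequence `a`: the C⋆-inductive limit of the matrix algebras
`M_{a 0} ⊗ ⋯ ⊗ M_{a (n-1)}` under the embeddings `x ↦ x ⊗ 1`. -/
abbrev UHFAlg : Type := (limCStarNorm a).Compl

/-- The canonical embedding of `Mat a n` into the UHF algebra. -/
def toUHF (n : ℕ) : Mat a n →⋆ₐ[ℂ] UHFAlg a := (limCStarNorm a).toCompl.comp (toAlgLim a n)

lemma toUHF_psi (n : ℕ) (x : Mat a n) : toUHF a (n + 1) (psi a n x) = toUHF a n x := by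
  rw [toUHF, StarAlgHom.comp_apply, toAlgLim_psi]; rfl

variable {a} in
/-- The ⋆-homomorphism on the UHF algebra induced by a compatible family on the `Mat a n`. -/
def liftUHF {B : Type*} [CStarAlgebra B] (g : ∀ n, Mat a n →⋆ₐ[ℂ] B)
    (hg : ∀ n x, g (n + 1) (psi a n x) = g n x) : UHFAlg a →⋆ₐ[ℂ] B :=
  (limCStarNorm a).extend
    { DirectLimit.Algebra.lift (R := ℂ) (Mat a) (psiLE a) B
        (fun n => (g n : Mat a n →ₐ[ℂ] B)) (psiLE_compat a (fun n => ⇑(g n)) hg) with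
      map_star' := fun x => by
        obtain ⟨n, x, rfl⟩ := exists_toAlgLim a x
        exact map_star (g n) x }
    (fun x => by
      obtain ⟨n, x, rfl⟩ := exists_toAlgLim a x
      exact NonUnitalStarAlgHom.norm_apply_le (g n) x)

variable {a} in
lemma liftUHF_toUHF {B : Type*} [CStarAlgebra B] (g : ∀ n, Mat a n →⋆ₐ[ℂ] B)
    (hg : ∀ n x, g (n + 1) (psi a n x) = g n x) (n : ℕ) (x : Mat a n) :
    liftUHF g hg (toUHF a n x) = g n x :=
  (limCStarNorm a).extend_toCompl _ _ (toAlgLim a n x)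

variable {a} in
lemma norm_liftUHF {B : Type*} [CStarAlgebra B] [Nontrivial B] (g : ∀ n, Mat a n →⋆ₐ[ℂ] B)
    (hg : ∀ n x, g (n + 1) (psi a n x) = g n x) (x : UHFAlg a) : ‖liftUHF g hg x‖ = ‖x‖ := by
  have hc : Continuous (liftUHF g hg) := AddMonoidHomClass.continuous_of_bound _ 1 fun x => by
    simpa using NonUnitalStarAlgHom.norm_apply_le (liftUHF g hg) x
  refine (limCStarNorm a).denseRange_toCompl.induction_on
    (p := fun x => ‖liftUHF g hg x‖ = ‖x‖) x (isClosed_eq hc.norm continuous_norm) fun x => ?_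
  obtain ⟨n, x, rfl⟩ := exists_toAlgLim _ x
  change ‖liftUHF g hg (toUHF a n x)‖ = _
  rw [liftUHF_toUHF, NonUnitalStarAlgHom.norm_map (g n)
    (RingHom.injective (g n : Mat a n →+* B)), CStarSeminorm.norm_toCompl, limCStarNorm_toAlgLim]

lemma toUHF_psiLE (m n : ℕ) (h : m ≤ n) (x : Mat a m) :
    toUHF a n (psiLE a m n h x) = toUHF a m x :=
  psiLE_compat a (fun n x => toUHF a n x) (toUHF_psi a) m n h x

/-! ### The isomorphisms `φ_{a,b}` -/

/-- The bijection `j = b * j' + j'' ↔ (j', j'')` (indices starting from `0`). -/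
def finSplit (n : ℕ) : Fin ((a * b).1 n) ≃ Fin (a.1 n) × Fin (b.1 n) :=
  (finProdFinEquiv (m := a.1 n) (n := b.1 n)).symm

/-- The componentwise bijection `J ↔ (J', J'')`. -/
def idxSplit (n : ℕ) : Idx (a * b) n ≃ Idx a n × Idx b n where
  toFun j := (fun i => (finSplit a b i (j i)).1, fun i => (finSplit a b i (j i)).2)
  invFun j := fun i => (finSplit a b i).symm (j.1 i, j.2 i)
  left_inv j := by ext i; simp
  right_inv j := by ext i <;> simp

/-- Renaming the indices of matrices. -/
def reindexStar {m n : Type*} [Fintype m] [DecidableEq m] [Fintype n] [DecidableEq n]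
    (e : m ≃ n) : Matrix m m ℂ ≃⋆ₐ[ℂ] Matrix n n ℂ :=
  .ofAlgEquiv (Matrix.reindexAlgEquiv ℂ ℂ e) fun x => by
    simp [Matrix.star_eq_conjTranspose]

/-- The Kronecker product as an isomorphism of `Mat a n ⊗ Mat b n` with `Mat (a * b) n`. -/
def kronLevel (n : ℕ) : Mat a n ⊗[ℂ] Mat b n ≃⋆ₐ[ℂ] Mat (a * b) n :=
  (Matrix.kroneckerStarAlgEquiv (Idx a n) (Idx b n) ℂ).trans (reindexStar (idxSplit a b n).symm)

lemma kronLevel_tmul (n : ℕ) (x : Mat a n) (y : Mat b n) :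
    kronLevel a b n (x ⊗ₜ y) = (x ⊗ₖ y).submatrix (idxSplit a b n) (idxSplit a b n) := by
  have h : Matrix.kroneckerStarAlgEquiv (Idx a n) (Idx b n) ℂ (x ⊗ₜ y) = x ⊗ₖ y := by simp
  change reindexStar _ (Matrix.kroneckerStarAlgEquiv (Idx a n) (Idx b n) ℂ (x ⊗ₜ y)) = _
  rw [h]
  rfl

lemma psi_kronLevel (n : ℕ) (x : Mat a n) (y : Mat b n) :
    psi (a * b) n (kronLevel a b n (x ⊗ₜ y)) = kronLevel a b (n + 1) (psi a n x ⊗ₜ psi b n y) := by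
  rw [kronLevel_tmul, kronLevel_tmul]
  ext i j
  have h : (1 : Matrix (Fin ((a * b).1 n)) (Fin ((a * b).1 n)) ℂ) (i (Fin.last n)) (j (Fin.last n))
      = (1 : Matrix (Fin (a.1 n)) (Fin (a.1 n)) ℂ) (finSplit a b n (i (Fin.last n))).1
          (finSplit a b n (j (Fin.last n))).1
        * (1 : Matrix (Fin (b.1 n)) (Fin (b.1 n)) ℂ) (finSplit a b n (i (Fin.last n))).2
          (finSplit a b n (j (Fin.last n))).2 := by
    simp only [Matrix.one_apply, ← (finSplit a b n).injective.eq_iff, Prod.ext_iff, ite_and,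
      mul_ite, mul_one, mul_zero]
    split_ifs <;> rfl
  simp only [psi_apply, Matrix.submatrix_apply, Matrix.kroneckerMap_apply, splitLast_apply]
  rw [h]
  exact mul_mul_mul_comm _ _ _ _

/-- The tensor product of two ⋆-homomorphisms. -/
def mapTensor {A B C D : Type*} [Ring A] [StarRing A] [Algebra ℂ A] [StarModule ℂ A]
    [Ring B] [StarRing B] [Algebra ℂ B] [StarModule ℂ B]
    [Ring C] [StarRing C] [Algebra ℂ C] [StarModule ℂ C]
    [Ring D] [StarRing D] [Algebra ℂ D] [StarModule ℂ D]
    (f : A →⋆ₐ[ℂ] C) (g : B →⋆ₐ[ℂ] D) : A ⊗[ℂ] B →⋆ₐ[ℂ] C ⊗[ℂ] D :=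
  { Algebra.TensorProduct.map (f : A →ₐ[ℂ] C) (g : B →ₐ[ℂ] D) with
    map_star' := fun x => by
      change Algebra.TensorProduct.map (f : A →ₐ[ℂ] C) (g : B →ₐ[ℂ] D) (star x) =
        star (Algebra.TensorProduct.map (f : A →ₐ[ℂ] C) (g : B →ₐ[ℂ] D) x)
      induction x with
      | zero => simp
      | add x y hx hy => rw [star_add, map_add, map_add, star_add, hx, hy]
      | tmul x y => simp [map_star] }

/-- The map `φ_{a,b}^{(n)}`, followed by the inclusion into `UHFAlg a ⊗ UHFAlg b`. -/
def phiLevel (n : ℕ) : Mat (a * b) n →⋆ₐ[ℂ] MinTensor (UHFAlg a) (UHFAlg b) :=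
  ((minNorm (UHFAlg a) (UHFAlg b)).toCompl.comp (mapTensor (toUHF a n) (toUHF b n))).comp
    (kronLevel a b n).symm

lemma phiLevel_kronLevel (n : ℕ) (x : Mat a n) (y : Mat b n) :
    phiLevel a b n (kronLevel a b n (x ⊗ₜ y)) = minTmul (toUHF a n x) (toUHF b n y) := by
  have h : (kronLevel a b n).symm (kronLevel a b n (x ⊗ₜ y)) = x ⊗ₜ y :=
    StarAlgEquiv.symm_apply_apply _ _
  change (minNorm (UHFAlg a) (UHFAlg b)).toCompl (mapTensor (toUHF a n) (toUHF b n)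
    ((kronLevel a b n).symm (kronLevel a b n (x ⊗ₜ y)))) = _
  rw [h]
  rfl

variable {a b} in
lemma eq_of_kronLevel {E : Type*} [AddCommMonoid E] {n : ℕ} (f g : Mat (a * b) n →+ E)
    (h : ∀ x y, f (kronLevel a b n (x ⊗ₜ y)) = g (kronLevel a b n (x ⊗ₜ y))) (x : Mat (a * b) n) :
    f x = g x := by
  obtain ⟨z, rfl⟩ := (kronLevel a b n).surjective x
  induction z with
  | zero => rw [map_zero, map_zero, map_zero]
  | add x y hx hy => rw [map_add, map_add, map_add, hx, hy]
  | tmul x y => exact h x y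

lemma phiLevel_psi (n : ℕ) (x : Mat (a * b) n) :
    phiLevel a b (n + 1) (psi (a * b) n x) = phiLevel a b n x := by
  refine eq_of_kronLevel
    (AddMonoidHomClass.toAddMonoidHom ((phiLevel a b (n + 1)).comp (psi (a * b) n)))
    (AddMonoidHomClass.toAddMonoidHom (phiLevel a b n)) (fun x y => ?_) x
  change phiLevel a b (n + 1) (psi (a * b) n _) = phiLevel a b n _
  rw [psi_kronLevel, phiLevel_kronLevel, phiLevel_kronLevel, toUHF_psi, toUHF_psi]

lemma single_eq_kronLevel (n : ℕ) (j k : Idx (a * b) n) :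
    Matrix.single j k (1 : ℂ) = kronLevel a b n
      (Matrix.single (idxSplit a b n j).1 (idxSplit a b n k).1 1 ⊗ₜ
        Matrix.single (idxSplit a b n j).2 (idxSplit a b n k).2 1) := by
  rw [kronLevel_tmul]
  ext p q
  simp only [Matrix.single_apply, Matrix.submatrix_apply, Matrix.kroneckerMap_apply,
    ← (idxSplit a b n).injective.eq_iff, Prod.ext_iff, mul_ite, mul_one, mul_zero]
  split_ifs <;> simp_all

/-- The ⋆-homomorphism `φ_{a,b}` from `UHFAlg (a * b)` to `UHFAlg a ⊗ UHFAlg b`. -/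
def phiHom : UHFAlg (a * b) →⋆ₐ[ℂ] MinTensor (UHFAlg a) (UHFAlg b) :=
  liftUHF (phiLevel a b) (phiLevel_psi a b)

lemma phiHom_kronLevel (n : ℕ) (x : Mat a n) (y : Mat b n) :
    phiHom a b (toUHF (a * b) n (kronLevel a b n (x ⊗ₜ y)))
      = minTmul (toUHF a n x) (toUHF b n y) := by
  rw [phiHom, liftUHF_toUHF, phiLevel_kronLevel]

/-! ### Product states -/

/-- Density matrices: positive matrices of trace one. -/
abbrev Density (n : ℕ) : Type := {T : Matrix (Fin n) (Fin n) ℂ // T.PosSemidef ∧ T.trace = 1}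

/-- Sequences of density matrices `T n ∈ M_{a n}`. -/
abbrev DensitySeq (a : Seq2) : Type := (n : ℕ) → Density (a.1 n)

variable {a b} (T : DensitySeq a) (R : DensitySeq b)

/-- The density matrix `T 0 ⊗ ⋯ ⊗ T (n-1)`. -/
def tensorDensity (n : ℕ) : Mat a n := .of fun j k => ∏ i : Fin n, (T i).1 (j i) (k i)

lemma tensorDensity_succ (n : ℕ) : tensorDensity T (n + 1) =
    (tensorDensity T n ⊗ₖ (T n).1).submatrix (splitLast a n) (splitLast a n) := by
  ext j k
  exact Fin.prod_univ_castSucc _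

lemma trace_submatrix_equiv {m n : Type*} [Fintype m] [Fintype n] (e : m ≃ n)
    (x : Matrix n n ℂ) : (x.submatrix e e).trace = x.trace :=
  e.sum_comp fun i => x i i

lemma tensorDensity_mem (n : ℕ) :
    (tensorDensity T n).PosSemidef ∧ (tensorDensity T n).trace = 1 := by
  induction n with
  | zero =>
    have h : tensorDensity T 0 = 1 := by
      ext j k
      rw [Subsingleton.elim j k, Matrix.one_apply_eq]
      simp [tensorDensity]
    rw [h]
    exact ⟨Matrix.PosSemidef.one, by simp⟩
  | succ n ih =>
    rw [tensorDensity_succ, trace_submatrix_equiv, Matrix.trace_kronecker, ih.2, (T n).2.2, one_mul]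
    exact ⟨(ih.1.kronecker (T n).2.1).submatrix _, rfl⟩

/-- The state `x ↦ tr ((T 0 ⊗ ⋯ ⊗ T (n-1)) x)` of `Mat a n`. -/
def levelState (n : ℕ) : State (Mat a n) where
  toPositive := .mk₀ (Matrix.traceLinearMap (Idx a n) ℂ ℂ ∘ₗ
      LinearMap.mulLeft ℂ (tensorDensity T n)) (fun x hx => by
    obtain ⟨y, rfl⟩ := CStarAlgebra.nonneg_iff_eq_star_mul_self.mp hx
    change 0 ≤ (tensorDensity T n * (star y * y)).trace
    rw [← mul_assoc, Matrix.trace_mul_comm, ← mul_assoc]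
    exact ((tensorDensity_mem T n).1.mul_mul_conjTranspose_same y).trace_nonneg)
  map_one' := by
    change (tensorDensity T n * 1).trace = 1
    rw [mul_one, (tensorDensity_mem T n).2]

lemma levelState_apply (n : ℕ) (x : Mat a n) :
    (levelState T n).toPositive x = (tensorDensity T n * x).trace := rfl

lemma levelState_psi (n : ℕ) (x : Mat a n) :
    (levelState T (n + 1)).toPositive (psi a n x) = (levelState T n).toPositive x := by
  rw [levelState_apply, levelState_apply, psi_apply, tensorDensity_succ,
    Matrix.submatrix_mul_equiv, trace_submatrix_equiv, ← Matrix.mul_kronecker_mul,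
    Matrix.trace_kronecker, mul_one, (T n).2.2, mul_one]

/-- The product state `ω_T` of the UHF algebra, determined by
`ω_T(x) = tr ((T 0 ⊗ ⋯ ⊗ T (n-1)) x)` for `x` in `Mat a n`. -/
def productState : State (UHFAlg a) :=
  State.extend (limCStarNorm a)
    (DirectLimit.Module.lift ℂ ℕ (Mat a) (psiLE a)
      (fun n => (levelState T n).toPositive.toLinearMap)
      (psiLE_compat a (fun n x => (levelState T n).toPositive x) (levelState_psi T)))
    (by
      rw [← map_one (toAlgLim a 0)]
      exact (levelState T 0).map_one')
    (fun x => by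
      obtain ⟨n, x, rfl⟩ := exists_toAlgLim a x
      rw [← map_star, ← map_mul]
      exact (levelState T n).toPositive.map_nonneg (star_mul_self_nonneg x))
    (fun x => by
      obtain ⟨n, x, rfl⟩ := exists_toAlgLim a x
      exact (levelState T n).norm_apply_le x)

lemma productState_toUHF (n : ℕ) (x : Mat a n) :
    (productState T).toPositive (toUHF a n x) = (tensorDensity T n * x).trace :=
  State.extend_toCompl (limCStarNorm a) _ _ _ _ (toAlgLim a n x)

/-- `ω_T(E_{j_1,k_1} ⊗ ⋯ ⊗ E_{j_n,k_n}) = T^{(1)}_{k_1,j_1} ⋯ T^{(n)}_{k_n,j_n}`. -/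
lemma productState_single (n : ℕ) (j k : Idx a n) :
    (productState T).toPositive (toUHF a n (Matrix.single j k 1))
      = ∏ i : Fin n, (T i).1 (k i) (j i) := by
  rw [productState_toUHF, Matrix.trace_mul_comm, Matrix.trace_single_mul, one_smul]
  rfl

/-- The Kronecker product of two matrices, with index `j = b * j' + j''` (from `0`). -/
def kron (n : ℕ) (x : Matrix (Fin (a.1 n)) (Fin (a.1 n)) ℂ)
    (y : Matrix (Fin (b.1 n)) (Fin (b.1 n)) ℂ) :
    Matrix (Fin ((a * b).1 n)) (Fin ((a * b).1 n)) ℂ :=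
  (x ⊗ₖ y).submatrix (finSplit a b n) (finSplit a b n)

/-- The componentwise Kronecker product `T ⊠ R` of sequences of density matrices. -/
def boxtimes : DensitySeq (a * b) := fun n =>
  ⟨kron n (T n).1 (R n).1, ((T n).2.1.kronecker (R n).2.1).submatrix _, by
    rw [kron, trace_submatrix_equiv, Matrix.trace_kronecker, (T n).2.2, (R n).2.2, one_mul]⟩

/-! ### Bijectivity of `φ_{a,b}` -/

variable (a b)

/-- The density matrix `E_{1,1}`. -/
instance : Inhabited (DensitySeq a) := ⟨fun n => ⟨Matrix.single 0 0 1,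
  by
    rw [← Matrix.diagonal_single]
    exact Matrix.PosSemidef.diagonal (fun i => by
      by_cases h : i = 0 <;> simp [h]),
  by simp⟩⟩

instance : Nontrivial (MinTensor (UHFAlg a) (UHFAlg b)) := by
  refine ⟨⟨0, 1, fun h => ?_⟩⟩
  have h1 := (stateTensor (productState (default : DensitySeq a))
    (productState (default : DensitySeq b))).map_one'
  rw [← h, map_zero] at h1
  exact zero_ne_one h1

lemma norm_phiHom (x : UHFAlg (a * b)) : ‖phiHom a b x‖ = ‖x‖ := norm_liftUHF _ _ x

lemma minTmul_mem_closure (x : UHFAlg a) (y : UHFAlg b) :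
    minTmul x y ∈ closure (Set.range (phiHom a b)) := by
  refine isClosed_property ((limCStarNorm a).denseRange_toCompl.prodMap
      (limCStarNorm b).denseRange_toCompl)
    (p := fun z : UHFAlg a × UHFAlg b => minTmul z.1 z.2 ∈ closure (Set.range (phiHom a b)))
    (isClosed_closure.preimage continuous_minTmul) (fun z => subset_closure ?_) (x, y)
  obtain ⟨x, y⟩ := z
  obtain ⟨m, x, rfl⟩ := exists_toAlgLim _ x
  obtain ⟨n, y, rfl⟩ := exists_toAlgLim _ y
  change minTmul (toUHF a m x) (toUHF b n y) ∈ _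
  rw [← toUHF_psiLE a m (max m n) (le_max_left _ _), ← toUHF_psiLE b n (max m n) (le_max_right _ _),
    ← phiHom_kronLevel]
  exact Set.mem_range_self _

lemma denseRange_phiHom : DenseRange (phiHom a b) := by
  let S := (AddMonoidHomClass.toAddMonoidHom (phiHom a b)).range.topologicalClosure
  have hS (z : UHFAlg a ⊗[ℂ] UHFAlg b) : (minNorm (UHFAlg a) (UHFAlg b)).toCompl z ∈ S := by
    induction z with
    | zero => rw [map_zero]; exact S.zero_mem
    | add x y hx hy => rw [map_add]; exact S.add_mem hx hy
    | tmul x y => exact minTmul_mem_closure a b x y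
  intro z
  exact (minNorm (UHFAlg a) (UHFAlg b)).denseRange_toCompl.induction_on (p := fun z => z ∈ S) z
    (AddSubgroup.isClosed_topologicalClosure _) hS

lemma phiHom_bijective : Function.Bijective (phiHom a b) := by
  have hi : Isometry (phiHom a b) :=
    AddMonoidHomClass.isometry_of_norm (phiHom a b) (norm_phiHom a b)
  refine ⟨hi.injective, ?_⟩
  rw [← Set.range_eq_univ, ← hi.isClosedEmbedding.isClosed_range.closure_eq]
  exact (denseRange_phiHom a b).closure_range

/-- The ⋆-isomorphism `φ_{a,b}` from `UHFAlg (a * b)` onto `UHFAlg a ⊗ UHFAlg b`. -/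
def phi : UHFAlg (a * b) ≃⋆ₐ[ℂ] MinTensor (UHFAlg a) (UHFAlg b) :=
  StarAlgEquiv.ofBijective (phiHom a b) (phiHom_bijective a b)

lemma phi_single (n : ℕ) (j k : Idx (a * b) n) :
    phi a b (toUHF (a * b) n (Matrix.single j k 1)) =
      minTmul (toUHF a n (Matrix.single (fun i => (finSplit a b i (j i)).1)
          (fun i => (finSplit a b i (k i)).1) 1))
        (toUHF b n (Matrix.single (fun i => (finSplit a b i (j i)).2)
          (fun i => (finSplit a b i (k i)).2) 1)) := by
  rw [single_eq_kronLevel]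
  exact phiHom_kronLevel a b n _ _

/-! ### The operation `⊗_φ` -/

variable {a b}

/-- `π ⊗_φ ρ = (π ⊗ ρ) ∘ φ_{a,b}` for representations. -/
def ptimesRep {H K : Type} [NormedAddCommGroup H] [InnerProductSpace ℂ H] [CompleteSpace H]
    [NormedAddCommGroup K] [InnerProductSpace ℂ K] [CompleteSpace K]
    (π : UHFAlg a →⋆ₐ[ℂ] (H →L[ℂ] H)) (ρ : UHFAlg b →⋆ₐ[ℂ] (K →L[ℂ] K)) :
    UHFAlg (a * b) →⋆ₐ[ℂ] (HilbertTensor H K →L[ℂ] HilbertTensor H K) :=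
  (repTensor π ρ).comp (phi a b : UHFAlg (a * b) →⋆ₐ[ℂ] MinTensor (UHFAlg a) (UHFAlg b))

/-- `f ⊗_φ g = (f ⊗ g) ∘ φ_{a,b}` for states. -/
def ptimesState (f : State (UHFAlg a)) (g : State (UHFAlg b)) : State (UHFAlg (a * b)) :=
  (stateTensor f g).comp (phi a b : UHFAlg (a * b) →⋆ₐ[ℂ] MinTensor (UHFAlg a) (UHFAlg b))

end UHFAlgebras

end UHF

end

noncomputable section

namespace UHF

open UniformSpace
open scoped TensorProduct ComplexOrder

/-! ### States and cyclicity of the GNS vector. -/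

namespace State

variable {A : Type*} [CStarAlgebra A] [PartialOrder A] [StarOrderedRing A]

/-! Part (i) is a computation with matrices at each finite level. The index bijection that defines
`φ_{a,b}` is the one that defines the Kronecker product, so both the density matrix of `T ⊠ R` on
the first `n` factors and the algebra element `kronLevel (x ⊗ y)` are Kronecker products read
through the same bijection `idxSplit`. Multiplicativity of the trace on Kronecker products then
gives `ω_T(x) ω_R(y)`, which is also the value of `ω_T ⊗_φ ω_R` there
(`productState_boxtimes_kronLevel`). Such elements span each matrix level, the union of the levels
is dense in the UHF algebra, and states are continuous, so the two states agree.

Part (ii) follows from (i) and uniqueness of the GNS representation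
(`State.unitarilyEquivalent_gnsRep`): a representation with a cyclic vector `v` is determined up to
unitary equivalence by its vector state at `v`. Here the representation is `π_T ⊗_φ π_R` and `v` is
the tensor product of the two GNS vectors. By the construction of `stateTensor`, its vector state is
`ω_T ⊗_φ ω_R`. It is cyclic because `π(x)v ⊗ ρ(y)w` runs over the tensors of two dense families,
whose sums are dense in the Hilbert tensor product (`denseRange_repTensor_htmul`), and because
`φ_{a,b}` is surjective, so composing with it does not shrink the orbit. The argument uses no
property of product states: for arbitrary states `f` and `g`, `π_f ⊗_φ π_g` is the GNS
representation of `f ⊗_φ g`. Product states enter only through (i). -/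

lemma ext_apply {f g : State A} (h : ∀ x, f.toPositive x = g.toPositive x) : f = g := by
  obtain ⟨f, hf⟩ := f
  obtain ⟨g, hg⟩ := g
  obtain rfl : f = g := DFunLike.ext _ _ h
  rfl

lemma continuous_toPositive (f : State A) : Continuous f.toPositive :=
  AddMonoidHomClass.continuous_of_bound f.toPositive 1 fun x => by
    simpa using f.norm_apply_le x

/-- The GNS vector is the class of `1`, and the representation acts by left multiplication on
classes. -/
lemma gnsRep_apply_gnsVector (f : State A) (x : A) :
    f.gnsRep x f.gnsVector = ((f.toPositive.toPreGNS x : f.toPositive.PreGNS) : f.GNS) := by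
  change f.toPositive.gnsNonUnitalStarAlgHom x _ = _
  rw [gnsVector, PositiveLinearMap.gnsNonUnitalStarAlgHom_apply_coe]
  simp

/-- The vector `gnsVector` is cyclic for the GNS representation. -/
lemma denseRange_gnsRep_gnsVector (f : State A) :
    DenseRange fun x => f.gnsRep x f.gnsVector := by
  simp_rw [gnsRep_apply_gnsVector]
  -- The orbit of the GNS vector is exactly the image of the pre-Hilbert space in its completion.
  exact Completion.denseRange_coe.comp f.toPositive.toPreGNS.surjective.denseRange
    (Completion.continuous_coe _)

/-! ### Uniqueness of the GNS representation. -/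

section Cyclic

variable {H : Type*} [NormedAddCommGroup H] [InnerProductSpace ℂ H] [CompleteSpace H]
  (f : State A) (π : A →⋆ₐ[ℂ] (H →L[ℂ] H)) (v : H)

/-- `‖π(x)v‖² = ⟪v, π(x⋆x)v⟫ = f(x⋆x)`, the square of the GNS seminorm of `x`. In particular `x ↦
π(x)v` kills the null vectors of `f`, so it descends to the GNS space. -/
lemma norm_apply_vector (hf : ∀ x, f.toPositive x = inner ℂ v (π x v))
    (x : f.toPositive.PreGNS) : ‖π (f.toPositive.ofPreGNS x) v‖ = ‖x‖ := by
  rw [PositiveLinearMap.preGNS_norm_def, hf, map_mul, map_star, mul_apply_eq_comp,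
    ContinuousLinearMap.star_eq_adjoint, ContinuousLinearMap.adjoint_inner_right,
    norm_eq_sqrt_re_inner (𝕜 := ℂ)]
  rfl

/-- The isometry `[x] ↦ π(x) v` on the pre-Hilbert space of the GNS construction. -/
def preIntertwiner (hf : ∀ x, f.toPositive x = inner ℂ v (π x v)) :
    f.toPositive.PreGNS →ₗᵢ[ℂ] H where
  toFun x := π (f.toPositive.ofPreGNS x) v
  map_add' x y := by simp
  map_smul' c x := by simp
  norm_map' := f.norm_apply_vector π v hf

/-- The isometry of the GNS space extending `[x] ↦ π(x) v`. -/
def intertwiner (hf : ∀ x, f.toPositive x = inner ℂ v (π x v)) : f.GNS →ₗᵢ[ℂ] H where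
  toLinearMap := (f.preIntertwiner π v hf).toContinuousLinearMap.fromCompletion.toLinearMap
  norm_map' z := by
    change ‖(f.preIntertwiner π v hf).toContinuousLinearMap.fromCompletion z‖ = ‖z‖
    induction z using Completion.induction_on with
    | hp => exact isClosed_eq (by fun_prop) continuous_norm
    | ih x =>
      rw [ContinuousLinearMap.fromCompletion_apply_coe, Completion.norm_coe]
      exact (f.preIntertwiner π v hf).norm_map x

/-- This determines the isometry on a dense set; the case `x = 1` shows that it carries the GNS
vector to `v`. -/
lemma intertwiner_gnsRep_gnsVector (hf : ∀ x, f.toPositive x = inner ℂ v (π x v)) (x : A) :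
    f.intertwiner π v hf (f.gnsRep x f.gnsVector) = π x v := by
  rw [gnsRep_apply_gnsVector]
  exact ContinuousLinearMap.fromCompletion_apply_coe
    (f.preIntertwiner π v hf).toContinuousLinearMap (f.toPositive.toPreGNS x)

/-- By density and continuity it suffices to take `z` in the orbit of the GNS vector, say the class
of `y`; both sides are then `π(xy)v`. -/
lemma intertwiner_gnsRep (hf : ∀ x, f.toPositive x = inner ℂ v (π x v)) (x : A) (z : f.GNS) :
    f.intertwiner π v hf (f.gnsRep x z) = π x (f.intertwiner π v hf z) := by
  have hV := (f.intertwiner π v hf).continuous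
  refine f.denseRange_gnsRep_gnsVector.induction_on
    (p := fun z => f.intertwiner π v hf (f.gnsRep x z) = π x (f.intertwiner π v hf z)) z
    (isClosed_eq (hV.comp (f.gnsRep x).continuous) ((π x).continuous.comp hV)) fun y => ?_
  rw [← mul_apply_eq_comp, ← map_mul, intertwiner_gnsRep_gnsVector,
    intertwiner_gnsRep_gnsVector, map_mul, mul_apply_eq_comp]

/-- The range of an isometry on a complete space is closed, and this one contains the dense orbit of
`v`. -/
lemma intertwiner_surjective (hf : ∀ x, f.toPositive x = inner ℂ v (π x v))
    (hv : DenseRange fun x => π x v) : Function.Surjective (f.intertwiner π v hf) := by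
  have hc := (f.intertwiner π v hf).isometry.isClosedEmbedding.isClosed_range
  rw [← Set.range_eq_univ, ← hc.closure_eq]
  refine (hv.mono ?_).closure_eq
  rintro _ ⟨x, rfl⟩
  exact ⟨_, f.intertwiner_gnsRep_gnsVector π v hf x⟩

/-- Uniqueness of the GNS representation: a representation with a cyclic vector that induces
the state `f` is unitarily equivalent to the GNS representation of `f`. -/
theorem unitarilyEquivalent_gnsRep (hf : ∀ x, f.toPositive x = inner ℂ v (π x v))
    (hv : DenseRange fun x => π x v) : UnitarilyEquivalent π f.gnsRep := by
  let V := LinearIsometryEquiv.ofSurjective (f.intertwiner π v hf)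
    (f.intertwiner_surjective π v hf hv)
  -- The isometry `V` goes from the GNS space to `H`, so the required unitary is its inverse;
  -- applying `V` to both sides turns the claim into the intertwining relation for `V`.
  refine ⟨V.symm, fun x ξ => V.injective ?_⟩
  rw [V.apply_symm_apply]
  change _ = f.intertwiner π v hf (f.gnsRep x (V.symm ξ))
  rw [intertwiner_gnsRep]
  exact congrArg (π x) (V.apply_symm_apply ξ).symm

end Cyclic

end State

/-! ### Density of elementary tensors in the Hilbert tensor product. -/

section
variable {H K : Type*} [NormedAddCommGroup H] [InnerProductSpace ℂ H]
  [NormedAddCommGroup K] [InnerProductSpace ℂ K]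

lemma norm_htmul (x : H) (y : K) : ‖htmul x y‖ = ‖x‖ * ‖y‖ := by
  rw [htmul, LinearIsometry.norm_map, TensorProduct.norm_tmul]

/-- A bilinear map of bound `1`, by the cross-norm identity `norm_htmul`. Joint continuity is what
passes from dense families in the factors to all elementary tensors. -/
lemma continuous_htmul : Continuous fun z : H × K => htmul z.1 z.2 := by
  let L : H →ₗ[ℂ] K →ₗ[ℂ] HilbertTensor H K :=
    (TensorProduct.mk ℂ H K).compr₂ (ofAlg H K).toLinearMap
  exact (L.mkContinuous₂ 1 fun x y => by rw [one_mul]; exact (norm_htmul x y).le).continuous₂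

/-- A closed additive subgroup containing the elementary tensors of two dense families is
everything. -/
lemma mem_of_htmul_mem {X Y : Type*} {f : X → H} {g : Y → K} (hf : DenseRange f)
    (hg : DenseRange g) (S : AddSubgroup (HilbertTensor H K))
    (hS : IsClosed (S : Set (HilbertTensor H K))) (h : ∀ x y, htmul (f x) (g y) ∈ S)
    (z : HilbertTensor H K) : z ∈ S := by
  have h' (x : H) (y : K) : htmul x y ∈ S :=
    (hf.prodMap hg).induction_on (p := fun z : H × K => htmul z.1 z.2 ∈ S) (x, y)
      (hS.preimage continuous_htmul) fun z => h z.1 z.2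
  refine denseRange_ofAlg.induction_on (p := fun z => z ∈ S) z hS fun z => ?_
  -- Elements of the algebraic tensor product are finite sums of elementary tensors, scalars being
  -- absorbed into a factor; closure under addition is therefore enough.
  induction z with
  | zero => rw [map_zero]; exact S.zero_mem
  | add x y hx hy => rw [map_add]; exact S.add_mem hx hy
  | tmul x y => exact h' x y

end

/-! ### Cyclic vectors of tensor product representations. -/

section
universe u
variable {A B : Type u} [CStarAlgebra A] [CStarAlgebra B]
  {H K : Type u} [NormedAddCommGroup H] [InnerProductSpace ℂ H] [CompleteSpace H]
  [NormedAddCommGroup K] [InnerProductSpace ℂ K] [CompleteSpace K]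

/-- The elementary tensor of two cyclic vectors is cyclic. -/
lemma denseRange_repTensor_htmul (π : A →⋆ₐ[ℂ] (H →L[ℂ] H)) (ρ : B →⋆ₐ[ℂ] (K →L[ℂ] K))
    {v : H} {w : K} (hv : DenseRange fun x => π x v) (hw : DenseRange fun y => ρ y w) :
    DenseRange fun z => repTensor π ρ z (htmul v w) := by
  -- The orbit map as an additive homomorphism, so that the closure of the orbit is a closed
  -- additive subgroup.
  let F : MinTensor A B →+ HilbertTensor H K :=
    { toFun := fun z => repTensor π ρ z (htmul v w)
      map_zero' := by simp
      map_add' := by simp }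
  intro z
  -- The vector `π(x)v ⊗ ρ(y)w` lies in the orbit itself, being the image of `v ⊗ w` under `x ⊗ y`.
  refine mem_of_htmul_mem hv hw F.range.topologicalClosure
    (AddSubgroup.isClosed_topologicalClosure _) (fun x y => subset_closure ⟨minTmul x y, ?_⟩) z
  change repTensor π ρ (minTmul x y) (htmul v w) = _
  rw [repTensor_minTmul, opTensor_htmul]

end

/-! ### Product states on UHF algebras and the operation `⊗_φ`. -/

section UHFAlgebras
open scoped Kronecker Matrix.Norms.L2Operator MatrixOrder

variable {a b : Seq2}

/-- The matrix levels have dense union and states are continuous. -/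
lemma State.ext_toUHF {f g : State (UHFAlg a)}
    (h : ∀ n x, f.toPositive (toUHF a n x) = g.toPositive (toUHF a n x)) : f = g := by
  refine State.ext_apply fun x => ?_
  refine (limCStarNorm a).denseRange_toCompl.induction_on
    (p := fun x => f.toPositive x = g.toPositive x) x
    (isClosed_eq f.continuous_toPositive g.continuous_toPositive) fun x => ?_
  obtain ⟨n, x, rfl⟩ := exists_toAlgLim _ x
  exact h n x

/-- Entrywise, a product of `n` factors `T·R` splits into the product of the `T` entries and that of
the `R` entries; `idxSplit` is `finSplit` in each component, so the indices agree by definition. -/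
lemma tensorDensity_boxtimes (T : DensitySeq a) (R : DensitySeq b) (n : ℕ) :
    tensorDensity (boxtimes T R) n = (tensorDensity T n ⊗ₖ tensorDensity R n).submatrix
      (idxSplit a b n) (idxSplit a b n) := by
  ext j k
  exact Finset.prod_mul_distrib (s := Finset.univ)
    (f := fun i : Fin n => (T i).1 (finSplit a b i (j i)).1 (finSplit a b i (k i)).1)
    (g := fun i : Fin n => (R i).1 (finSplit a b i (j i)).2 (finSplit a b i (k i)).2)

/-- Density and element are Kronecker products under the same reindexing, which does not affect the
trace; then `tr((T ⊗ R)(x ⊗ y)) = tr(Tx) tr(Ry)`. -/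
lemma productState_boxtimes_kronLevel (T : DensitySeq a) (R : DensitySeq b) (n : ℕ)
    (x : Mat a n) (y : Mat b n) :
    (productState (boxtimes T R)).toPositive (toUHF (a * b) n (kronLevel a b n (x ⊗ₜ y))) =
      (productState T).toPositive (toUHF a n x) * (productState R).toPositive (toUHF b n y) := by
  rw [productState_toUHF, productState_toUHF,
    productState_toUHF, kronLevel_tmul, tensorDensity_boxtimes, Matrix.submatrix_mul_equiv,
    trace_submatrix_equiv, ← Matrix.mul_kronecker_mul, Matrix.trace_kronecker]

/-- Replaces the isomorphism `phi` by the homomorphism `phiHom` with the same underlying map, for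
which the value on Kronecker products is known. -/
lemma ptimesState_apply (f : State (UHFAlg a)) (g : State (UHFAlg b)) (x : UHFAlg (a * b)) :
    (ptimesState f g).toPositive x = (stateTensor f g).toPositive (phiHom a b x) :=
  State.comp_apply _ _ x

lemma stateTensor_apply (f : State (UHFAlg a)) (g : State (UHFAlg b))
    (z : MinTensor (UHFAlg a) (UHFAlg b)) :
    (stateTensor f g).toPositive z = inner ℂ (htmul f.gnsVector g.gnsVector)
      (repTensor f.gnsRep g.gnsRep z (htmul f.gnsVector g.gnsVector)) :=
  rfl

theorem ptimesState_productState (T : DensitySeq a) (R : DensitySeq b) :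
    ptimesState (productState T) (productState R) = productState (boxtimes T R) := by
  refine State.ext_toUHF fun n x => ?_
  -- Every element of a level is a sum of Kronecker products `x ⊗ y`, so two additive maps need only
  -- be compared on these.
  refine eq_of_kronLevel
    (((ptimesState (productState T) (productState R)).toPositive.toLinearMap.comp
      (toUHF (a * b) n).toAlgHom.toLinearMap).toAddMonoidHom)
    (((productState (boxtimes T R)).toPositive.toLinearMap.comp
      (toUHF (a * b) n).toAlgHom.toLinearMap).toAddMonoidHom) (fun x y => ?_) x
  refine Eq.trans ?_ (productState_boxtimes_kronLevel T R n x y).symm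
  refine (ptimesState_apply _ _ _).trans ?_
  refine (congrArg _ (phiHom_kronLevel a b n x y)).trans ?_
  exact stateTensor_minTmul _ _ _ _

lemma ptimesRep_apply {H K : Type} [NormedAddCommGroup H] [InnerProductSpace ℂ H] [CompleteSpace H]
    [NormedAddCommGroup K] [InnerProductSpace ℂ K] [CompleteSpace K]
    (π : UHFAlg a →⋆ₐ[ℂ] (H →L[ℂ] H)) (ρ : UHFAlg b →⋆ₐ[ℂ] (K →L[ℂ] K)) (x : UHFAlg (a * b)) :
    ptimesRep π ρ x = repTensor π ρ (phiHom a b x) := rfl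

/-- `stateTensor` is by construction the vector state at the tensor of the GNS vectors. This is the
hypothesis `hf` of `State.unitarilyEquivalent_gnsRep`. -/
lemma ptimesState_apply_eq_inner (f : State (UHFAlg a)) (g : State (UHFAlg b))
    (x : UHFAlg (a * b)) : (ptimesState f g).toPositive x =
      inner ℂ (htmul f.gnsVector g.gnsVector)
        (ptimesRep f.gnsRep g.gnsRep x (htmul f.gnsVector g.gnsVector)) := by
  have h : (stateTensor f g).toPositive (phiHom a b x) = inner ℂ (htmul f.gnsVector g.gnsVector)
      (repTensor f.gnsRep g.gnsRep (phiHom a b x) (htmul f.gnsVector g.gnsVector)) :=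
    stateTensor_apply f g (phiHom a b x)
  rw [← ptimesRep_apply] at h
  exact (ptimesState_apply f g x).trans h

/-- Since `phiHom` is onto, the orbit of `v ⊗ w` under the composed representation contains its
orbit under the whole minimal tensor product. -/
lemma denseRange_ptimesRep_htmul {H K : Type}
    [NormedAddCommGroup H] [InnerProductSpace ℂ H] [CompleteSpace H]
    [NormedAddCommGroup K] [InnerProductSpace ℂ K] [CompleteSpace K]
    (π : UHFAlg a →⋆ₐ[ℂ] (H →L[ℂ] H)) (ρ : UHFAlg b →⋆ₐ[ℂ] (K →L[ℂ] K))
    {v : H} {w : K} (hv : DenseRange fun x => π x v) (hw : DenseRange fun y => ρ y w) :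
    DenseRange fun x => ptimesRep π ρ x (htmul v w) := by
  refine (denseRange_repTensor_htmul π ρ hv hw).mono ?_
  rintro _ ⟨z, rfl⟩
  obtain ⟨x, rfl⟩ := (phiHom_bijective a b).surjective z
  exact ⟨x, congrArg (fun S => S (htmul v w)) (ptimesRep_apply π ρ x)⟩

/-- The representation `π_f ⊗_φ π_g` is unitarily equivalent to the GNS representation of
`f ⊗_φ g`. -/
theorem unitarilyEquivalent_ptimesRep_gnsRep (f : State (UHFAlg a)) (g : State (UHFAlg b)) :
    UnitarilyEquivalent (ptimesRep f.gnsRep g.gnsRep) (ptimesState f g).gnsRep :=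
  (ptimesState f g).unitarilyEquivalent_gnsRep _ _ (ptimesState_apply_eq_inner f g)
    (denseRange_ptimesRep_htmul _ _ f.denseRange_gnsRep_gnsVector g.denseRange_gnsRep_gnsVector)

end UHFAlgebras

end UHF

end

theorem mainTheorem2 (a b : UHF.Seq2) (T : UHF.DensitySeq a) (R : UHF.DensitySeq b) :
    UHF.ptimesState (UHF.productState T) (UHF.productState R)
        = UHF.productState (UHF.boxtimes T R) ∧
      UHF.UnitarilyEquivalent
        (UHF.ptimesRep (UHF.productState T).gnsRep (UHF.productState R).gnsRep)
        (UHF.productState (UHF.boxtimes T R)).gnsRep := by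
  refine ⟨UHF.ptimesState_productState T R, ?_⟩
  -- By (i), the target is the GNS representation of `ω_T ⊗_φ ω_R`, and the statement for arbitrary
  -- states applies.
  rw [← UHF.ptimesState_productState]
  exact UHF.unitarilyEquivalent_ptimesRep_gnsRep _ _
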